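/- Let $G$ be a finite simple connected graph with $n$ vertices and $m$ edges. Its multiplicative degree-Kirchhoff index is $Kf^*(G)=\sum_{\{i,j\}} d_i d_j\,\Omega_{ij}(G)$, the sum over all unordered pairs of distinct vertices, where $d_i$ is the degree of $i$ and $\Omega_{ij}(G)$ is the resistance distance (the effective resistance between $i$ and $j$ when every edge of $G$ is a unit resistor). For an integer $k\ge 1$ let $S_k(G)$ be the graph obtained from $G$ by replacing each edge by $k$ parallel paths of length $2$, and let $S_k^0(G)=G$ and $S_k^r(G)=S_k(S_k^{r-1}(G))$ for $r\ge 1$. Then for every integer $k\ge 1$ $$Kf^*(S_k(G))=8k\,Kf^*(G)+2km(1+2km-2n),$$ and for all integers $k>2$ and $r\ge 1$ $$Kf^*(S_k^r(G))=(8k)^r Kf^*(G)+\frac{(2k)^r(4^r-1)}{3}(m-2mn)+\frac{k(4k)^r(k^r-2^r)}{k-2}m^2-\frac{k(2k)^r\left[4^r-2k(4^r-1)+3(2k)^r-4\right]}{3(k-2)(2k-1)}m^2 .$$ -/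

import Mathlib

universe u

/-- Kirchhoff's current law for a unit current that enters the network `G` (each edge a unit
resistor) at `i` and leaves it at `j`: the potential `φ` satisfies `L(G) φ = e_i - e_j`, where
`L(G)` is the combinatorial Laplacian. -/
def IsUnitFlowPotential {V : Type u} [Fintype V] [DecidableEq V] (G : SimpleGraph V)
    [DecidableRel G.Adj] (i j : V) (φ : V → ℝ) : Prop :=
  (G.lapMatrix ℝ).mulVec φ = Pi.single i 1 - Pi.single j 1

/-- The potential difference of a unit flow from `i` to `j` does not depend on the potential. -/
theorem IsUnitFlowPotential.sub_eq {V : Type u} [Fintype V] [DecidableEq V] {G : SimpleGraph V}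
    [DecidableRel G.Adj] {i j : V} {φ ψ : V → ℝ} (hφ : IsUnitFlowPotential G i j φ)
    (hψ : IsUnitFlowPotential G i j ψ) : φ i - φ j = ψ i - ψ j := by
  have h := Matrix.dotProduct_mulVec φ (G.lapMatrix ℝ) ψ
  rw [← Matrix.mulVec_transpose, (G.isSymm_lapMatrix (R := ℝ)).eq] at h
  unfold IsUnitFlowPotential at hφ hψ
  rw [hφ, hψ] at h
  simpa [dotProduct_sub, sub_dotProduct] using h

/-- In a connected finite graph a unit flow potential exists between any two vertices. -/
theorem exists_isUnitFlowPotential {V : Type u} [Fintype V] [DecidableEq V] {G : SimpleGraph V}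
    [DecidableRel G.Adj] (hG : G.Connected) (i j : V) :
    ∃ φ : V → ℝ, IsUnitFlowPotential G i j φ := by
  have hsum : ∀ x : V → ℝ, ∑ v, (G.lapMatrix ℝ).mulVec x v = 0 := by
    intro x
    have h := Matrix.dotProduct_mulVec (fun _ : V => (1 : ℝ)) (G.lapMatrix ℝ) x
    rw [← Matrix.mulVec_transpose, (G.isSymm_lapMatrix (R := ℝ)).eq,
      G.lapMatrix_mulVec_const_eq_zero] at h
    simpa [dotProduct] using h
  have hcard : (Fintype.card V : ℝ) ≠ 0 := by
    exact_mod_cast (Fintype.card_pos_iff.mpr ⟨i⟩).ne'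
  let T : (V → ℝ) →ₗ[ℝ] (V → ℝ) :=
    (G.lapMatrix ℝ).mulVecLin + LinearMap.pi fun _ => ∑ w, LinearMap.proj w
  have hT : ∀ x v, T x v = (G.lapMatrix ℝ).mulVec x v + ∑ w, x w := by
    intro x v
    simp [T]
  have hS : ∀ x, ∑ v, T x v = 0 → ∑ w, x w = 0 := by
    intro x hx
    simp only [hT, Finset.sum_add_distrib, hsum, Finset.sum_const, Finset.card_univ,
      nsmul_eq_mul, zero_add] at hx
    exact (mul_eq_zero.mp hx).resolve_left hcard
  have hinj : Function.Injective T := by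
    rw [injective_iff_map_eq_zero]
    intro x hx
    have hx0 := hS x (by simp [hx])
    have hL : (G.lapMatrix ℝ).mulVec x = 0 := by
      funext v
      have := hT x v
      rw [hx, hx0] at this
      simpa using this.symm
    have hc := G.lapMatrix_mulVec_eq_zero_iff_forall_reachable.mp hL
    funext v
    have : ∑ w, x w = (Fintype.card V : ℝ) * x v := by
      rw [Finset.sum_congr rfl fun w _ => hc w v (hG.preconnected w v)]
      simp
    rw [hx0] at this
    exact (mul_eq_zero.mp this.symm).resolve_left hcard
  obtain ⟨φ, hφ⟩ := LinearMap.injective_iff_surjective.mp hinj (Pi.single i 1 - Pi.single j 1)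
  refine ⟨φ, ?_⟩
  have h0 := hS φ (by simp [hφ])
  funext v
  have := hT φ v
  rw [hφ, h0, add_zero] at this
  exact this.symm

/-- The resistance distance `Ω_ij(G)`: the potential difference between `i` and `j` when a unit
current is sent from `i` to `j` through the network obtained from `G` by replacing each edge with
a unit resistor (with the value `0` if there is no such flow, which cannot happen when `G` is
connected). -/
noncomputable def resistanceDist {V : Type u} [Finite V] (G : SimpleGraph V) (i j : V) : ℝ :=
  letI := Fintype.ofFinite V
  letI := Classical.decEq V
  letI := Classical.decRel G.Adj
  letI := Classical.propDecidable (∃ φ : V → ℝ, IsUnitFlowPotential G i j φ)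
  if h : ∃ φ : V → ℝ, IsUnitFlowPotential G i j φ then h.choose i - h.choose j else 0

/-- The multiplicative degree-Kirchhoff index `Kf*(G)`, the sum of `d_i d_j Ω_ij(G)` over all
unordered pairs of vertices, written as half the sum over ordered pairs (`Ω_ii(G) = 0`). -/
noncomputable def multDegreeKirchhoff {V : Type u} [Finite V] (G : SimpleGraph V) : ℝ :=
  letI := Fintype.ofFinite V
  letI := Classical.decRel G.Adj
  (1 / 2 : ℝ) * ∑ i : V, ∑ j : V, (G.degree i : ℝ) * (G.degree j : ℝ) * resistanceDist G i j

/-- The `k`-parallel subdivision graph `S_k(G)`: each edge `e = uv` of `G` is replaced by `k`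
parallel paths `u, (e, l), v` of length two, `l = 0, …, k - 1`. Its vertices are those of `G`
and the `k` middle vertices `(e, l)` of every edge `e`. -/
def parallelSubdivision {V : Type u} (G : SimpleGraph V) (k : ℕ) :
    SimpleGraph (V ⊕ (G.edgeSet × Fin k)) where
  Adj
    | Sum.inl v, Sum.inr p => v ∈ (p.1 : Sym2 V)
    | Sum.inr p, Sum.inl v => v ∈ (p.1 : Sym2 V)
    | _, _ => False
  symm := ⟨by rintro (a | a) (b | b) h <;> exact h⟩
  loopless := ⟨by rintro (a | a) h <;> exact h⟩

/-- A finite simple graph together with its vertex set. -/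
structure FiniteGraph where
  /-- the vertex set -/
  vertex : Type u
  /-- the vertex set is finite -/
  finite : Finite vertex
  /-- the graph -/
  graph : SimpleGraph vertex

attribute [instance] FiniteGraph.finite

/-- The iterated graph `S_k^r(G)`: `S_k^0(G) = G` and `S_k^{r+1}(G) = S_k(S_k^r(G))`. -/
def FiniteGraph.iterSubdivision (G : FiniteGraph.{u}) (k : ℕ) : ℕ → FiniteGraph.{u}
  | 0 => G
  | r + 1 =>
    { vertex := (G.iterSubdivision k r).vertex ⊕ ((G.iterSubdivision k r).graph.edgeSet × Fin k)
      finite := inferInstance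
      graph := parallelSubdivision (G.iterSubdivision k r).graph k }

/-! All is computed from a Green kernel `g`: a unit current enters at `j` and leaves along a fixed
distribution `π`. Sinks cancel in differences, so resistances, and hence the index, are linear in
`g`: the index is the total degree times the weighted trace `∑ d_v g v v`, minus the form `∑ d_v d_w
g v w`.

In `S_k(G)` an edge becomes `k` parallel paths of resistance 2, that is, resistance `2/k`. So `2/k *
g` serves on old vertices, a middle vertex averages its two ends, and a source at a middle vertex
adds its own `1/2` there (`subdivisionKernel`). The form is then found by summing over incidences,
the trace by these sums and Foster's theorem, which brings in `n`.

Iterating with the edge and vertex counts of `S_k^r(G)` gives a linear recursion, solved by the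
closed form. -/

/-! ### Green kernels, resistance and the index -/

open Classical in
/-- The adjacency matrix as a real function. -/
noncomputable def adjWeight {V : Type u} (G : SimpleGraph V) (v w : V) : ℝ :=
  if G.Adj v w then 1 else 0

/-- The degree as a real number. -/
noncomputable def realDegree {V : Type u} [Fintype V] (G : SimpleGraph V) (v : V) : ℝ :=
  ∑ w, adjWeight G v w

open Classical in
/-- `g` is a Green kernel of `G` with sink distribution `π`: for all `j`, the Laplacian of
`g(·, j)` is `e_j - π`. -/
def IsGreenKernel {V : Type u} [Fintype V] (G : SimpleGraph V) (π : V → ℝ) (g : V → V → ℝ) :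
    Prop :=
  ∀ j v, realDegree G v * g v j - ∑ w, adjWeight G v w * g w j = (if v = j then 1 else 0) - π v

theorem adjWeight_eq_ite {V : Type u} (G : SimpleGraph V) (v w : V) [Decidable (G.Adj v w)] :
    adjWeight G v w = if G.Adj v w then 1 else 0 := by
  by_cases h : G.Adj v w <;> simp [adjWeight, h]

theorem adjWeight_comm {V : Type u} (G : SimpleGraph V) (v w : V) :
    adjWeight G v w = adjWeight G w v := by
  by_cases h : G.Adj v w
  · simp [adjWeight, h, h.symm]
  · simp [adjWeight, h, mt G.adj_symm h]

theorem realDegree_eq_degree {V : Type u} [Fintype V] (G : SimpleGraph V) [DecidableRel G.Adj]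
    (v : V) : realDegree G v = G.degree v := by
  classical
  rw [← SimpleGraph.card_neighborFinset_eq_degree, SimpleGraph.neighborFinset_eq_filter]
  rw [realDegree, ← Finset.sum_boole]
  exact Finset.sum_congr rfl fun w _ => adjWeight_eq_ite G v w

theorem lapMatrix_mulVec_eq {V : Type u} [Fintype V] [DecidableEq V] (G : SimpleGraph V)
    [DecidableRel G.Adj] (φ : V → ℝ) (v : V) :
    (G.lapMatrix ℝ).mulVec φ v = realDegree G v * φ v - ∑ w, adjWeight G v w * φ w := by
  rw [SimpleGraph.lapMatrix, Matrix.sub_mulVec, Pi.sub_apply, realDegree_eq_degree,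
    SimpleGraph.degMatrix, Matrix.mulVec_diagonal]
  congr 1
  refine Finset.sum_congr rfl fun w _ => ?_
  exact congrArg (· * φ w) (adjWeight_eq_ite G v w).symm

theorem resistanceDist_eq_of_isUnitFlowPotential {V : Type u} [Fintype V] [DecidableEq V]
    (G : SimpleGraph V) [DecidableRel G.Adj] {i j : V} {φ : V → ℝ}
    (hφ : IsUnitFlowPotential G i j φ) : resistanceDist G i j = φ i - φ j := by
  -- `resistanceDist` fixes classical instances, so the potential has to be moved to them.
  have key : ∀ (i1 : Fintype V) (i2 : DecidableEq V) (i3 : DecidableRel G.Adj),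
      @IsUnitFlowPotential V i1 i2 G i3 i j φ := by
    intro i1 i2 i3
    convert hφ
  unfold resistanceDist
  have hex : ∃ φ : V → ℝ, @IsUnitFlowPotential V (Fintype.ofFinite V) (Classical.decEq V) G
    (Classical.decRel G.Adj) i j φ := ⟨φ, key _ _ _⟩
  rw [dif_pos hex]
  exact @IsUnitFlowPotential.sub_eq V (Fintype.ofFinite V) (Classical.decEq V) G
    (Classical.decRel G.Adj) i j _ _ hex.choose_spec (key _ _ _)

/-- Superposition: `g(·, i) - g(·, j)` is a unit flow potential, because the two copies of `π`
cancel. -/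
theorem IsGreenKernel.resistanceDist_eq {V : Type u} [Fintype V] {G : SimpleGraph V} {π : V → ℝ}
    {g : V → V → ℝ} (hg : IsGreenKernel G π g) (i j : V) :
    resistanceDist G i j = g i i + g j j - g i j - g j i := by
  classical
  have h : IsUnitFlowPotential G i j (fun v => g v i - g v j) := by
    funext v
    rw [lapMatrix_mulVec_eq]
    have h1 := hg i v
    have h2 := hg j v
    simp only [mul_sub, Finset.sum_sub_distrib, Pi.sub_apply, Pi.single_apply]
    linarith
  rw [resistanceDist_eq_of_isUnitFlowPotential G h]
  ring

/-- Ground one vertex `o`: the sink is the point mass there. -/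
theorem SimpleGraph.Connected.exists_isGreenKernel {V : Type u} [Fintype V] {G : SimpleGraph V}
    (hG : G.Connected) : ∃ π g, IsGreenKernel G π g := by
  classical
  obtain ⟨o⟩ := hG.nonempty
  choose φ hφ using fun i => exists_isUnitFlowPotential hG i o
  refine ⟨fun v => if v = o then 1 else 0, fun v j => φ j v, fun j v => ?_⟩
  have h := congrFun (hφ j) v
  rw [lapMatrix_mulVec_eq] at h
  simpa [Pi.single_apply] using h

theorem multDegreeKirchhoff_eq_sum {V : Type u} [Fintype V] (G : SimpleGraph V) :
    multDegreeKirchhoff G =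
      (1 / 2 : ℝ) * ∑ i, ∑ j, realDegree G i * realDegree G j * resistanceDist G i j := by
  classical
  unfold multDegreeKirchhoff
  simp only [realDegree_eq_degree]
  congr!

theorem IsGreenKernel.multDegreeKirchhoff_eq {V : Type u} [Fintype V] {G : SimpleGraph V}
    {π : V → ℝ} {g : V → V → ℝ} (hg : IsGreenKernel G π g) :
    multDegreeKirchhoff G = (∑ v, realDegree G v) * ∑ v, realDegree G v * g v v
      - ∑ v, ∑ w, realDegree G v * realDegree G w * g v w := by
  rw [multDegreeKirchhoff_eq_sum]
  simp only [hg.resistanceDist_eq]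
  have h1 : ∑ i, ∑ j, realDegree G i * realDegree G j * g i i
      = (∑ v, realDegree G v) * ∑ v, realDegree G v * g v v := by
    rw [Finset.sum_mul_sum, Finset.sum_comm]
    refine Finset.sum_congr rfl fun i _ => Finset.sum_congr rfl fun j _ => by ring
  have h2 : ∑ i, ∑ j, realDegree G i * realDegree G j * g j j
      = (∑ v, realDegree G v) * ∑ v, realDegree G v * g v v := by
    rw [Finset.sum_mul_sum]
    refine Finset.sum_congr rfl fun i _ => Finset.sum_congr rfl fun j _ => by ring
  have h3 : ∑ i, ∑ j, realDegree G i * realDegree G j * g j i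
      = ∑ v, ∑ w, realDegree G v * realDegree G w * g v w := by
    rw [Finset.sum_comm]
    refine Finset.sum_congr rfl fun i _ => Finset.sum_congr rfl fun j _ => by ring
  simp only [mul_add, mul_sub, Finset.sum_add_distrib, Finset.sum_sub_distrib, h1, h2, h3]
  ring

theorem sum_realDegree {V : Type u} [Fintype V] (G : SimpleGraph V) :
    ∑ v, realDegree G v = 2 * G.edgeSet.ncard := by
  classical
  simp only [realDegree_eq_degree]
  rw [Set.ncard_eq_toFinset_card', ← SimpleGraph.edgeFinset]
  exact_mod_cast G.sum_degrees_eq_twice_card_edges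

/-- The image of the Laplacian has total mass zero. -/
theorem IsGreenKernel.sum_eq_one {V : Type u} [Fintype V] [Nonempty V] {G : SimpleGraph V}
    {π : V → ℝ} {g : V → V → ℝ} (hg : IsGreenKernel G π g) : ∑ v, π v = 1 := by
  classical
  obtain ⟨j⟩ := ‹Nonempty V›
  have h := Finset.sum_congr (rfl : (Finset.univ : Finset V) = _) fun v _ => hg j v
  simp only [Finset.sum_sub_distrib, Finset.sum_ite_eq', Finset.mem_univ, if_true] at h
  have h2 : ∑ v, ∑ w, adjWeight G v w * g w j = ∑ v, realDegree G v * g v j := by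
    rw [Finset.sum_comm]
    refine Finset.sum_congr rfl fun w _ => ?_
    simp only [realDegree, Finset.sum_mul, adjWeight_comm G w]
  linarith

/-- Foster's theorem in terms of a Green kernel. -/
theorem IsGreenKernel.sum_adjWeight_mul {V : Type u} [Fintype V] [Nonempty V]
    {G : SimpleGraph V} {π : V → ℝ} {g : V → V → ℝ} (hg : IsGreenKernel G π g) :
    ∑ v, ∑ w, adjWeight G v w * g v w
      = ∑ v, realDegree G v * g v v - Fintype.card V + 1 := by
  -- Trace of the Green equation: put `j = v` and sum.
  have h := Finset.sum_congr (rfl : (Finset.univ : Finset V) = _) fun v _ => hg v v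
  simp only [Finset.sum_sub_distrib, if_true, Finset.sum_const, Finset.card_univ,
    nsmul_eq_mul, mul_one, hg.sum_eq_one] at h
  have h2 : ∑ v, ∑ w, adjWeight G v w * g w v = ∑ v, ∑ w, adjWeight G v w * g v w := by
    rw [Finset.sum_comm]
    exact Finset.sum_congr rfl fun i _ => Finset.sum_congr rfl fun j _ => by
      rw [adjWeight_comm]
  linarith

/-! ### Vertex-edge incidence sums -/

open Classical in
/-- The incidence of a vertex and an edge as a real number. -/
noncomputable def incWeight {V : Type u} {G : SimpleGraph V} (e : G.edgeSet) (v : V) : ℝ :=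
  if v ∈ (e : Sym2 V) then 1 else 0

theorem sum_incWeight_vertex {V : Type u} [Fintype V] {G : SimpleGraph V} (e : G.edgeSet) :
    ∑ v, incWeight e v = 2 := by
  classical
  obtain ⟨e, he⟩ := e
  induction e with
  | _ a b =>
    have hab : a ≠ b := G.ne_of_adj he
    have : (Finset.univ.filter fun v => v ∈ s(a, b)) = {a, b} := by ext; simp
    simp only [incWeight, Finset.sum_boole, this, Finset.card_pair hab]
    norm_num

theorem sum_incWeight_mul_incWeight_of_ne {V : Type u} {G : SimpleGraph V}
    [Fintype G.edgeSet] {v w : V} (h : v ≠ w) :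
    ∑ e : G.edgeSet, incWeight e v * incWeight e w = adjWeight G v w := by
  classical
  simp only [incWeight, adjWeight, mul_ite, mul_one, mul_zero, ← ite_and]
  split_ifs with ha
  · rw [Finset.sum_eq_single (⟨s(v, w), ha⟩ : G.edgeSet)]
    · simp
    · intro e _ hne
      rw [if_neg]
      rintro ⟨h2, h1⟩
      exact hne (Subtype.ext ((Sym2.mem_and_mem_iff h).mp ⟨h1, h2⟩))
    · simp
  · refine Finset.sum_eq_zero fun e _ => if_neg ?_
    rintro ⟨h2, h1⟩
    have he : (e : Sym2 V) = s(v, w) :=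
      (Sym2.mem_and_mem_iff h).mp ⟨h1, h2⟩
    exact ha (by simpa [he] using e.2)

theorem sum_incWeight_edge {V : Type u} [Fintype V] {G : SimpleGraph V} [Fintype G.edgeSet]
    (v : V) : ∑ e : G.edgeSet, incWeight e v = realDegree G v := by
  classical
  -- With `x` the sum sought, the terms `w = v` give `x` and the others the degree `d`, so `x + d =
  -- 2 * x`.
  have h2 : ∑ e : G.edgeSet, ∑ w, incWeight e v * incWeight e w
      = ∑ e : G.edgeSet, 2 * incWeight e v := by
    refine Finset.sum_congr rfl fun e _ => ?_
    rw [← Finset.mul_sum, sum_incWeight_vertex, mul_comm]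
  have h3 : ∑ e : G.edgeSet, incWeight e v * incWeight e v = ∑ e : G.edgeSet, incWeight e v := by
    refine Finset.sum_congr rfl fun e _ => ?_
    unfold incWeight
    split_ifs <;> simp
  have h4 : realDegree G v = ∑ w ∈ Finset.univ.erase v, adjWeight G v w := by
    rw [realDegree, ← Finset.add_sum_erase _ _ (Finset.mem_univ v)]
    simp [adjWeight]
  rw [Finset.sum_comm, ← Finset.add_sum_erase _ _ (Finset.mem_univ v), h3,
    Finset.sum_congr rfl fun w hw =>
      sum_incWeight_mul_incWeight_of_ne (G := G) (Finset.ne_of_mem_erase hw).symm,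
    ← h4, ← Finset.mul_sum] at h2
  linarith

-- The incidence matrix times its transpose is adjacency plus degree matrix.
open Classical in
theorem sum_incWeight_mul_incWeight {V : Type u} [Fintype V] {G : SimpleGraph V}
    [Fintype G.edgeSet] (v w : V) :
    ∑ e : G.edgeSet, incWeight e v * incWeight e w
      = adjWeight G v w + if v = w then realDegree G v else 0 := by
  split_ifs with h
  · subst h
    rw [← sum_incWeight_edge v]
    simp only [adjWeight, SimpleGraph.irrefl, if_false, zero_add]
    refine Finset.sum_congr rfl fun e _ => ?_
    unfold incWeight
    split_ifs <;> simp
  · rw [sum_incWeight_mul_incWeight_of_ne h, add_zero]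

/-! ### Green kernel and index of one subdivision -/

section Subdivision

variable {V : Type u} {G : SimpleGraph V} {k : ℕ}

@[simp]
theorem adjWeight_parallelSubdivision_inl_inl (v w : V) :
    adjWeight (parallelSubdivision G k) (Sum.inl v) (Sum.inl w) = 0 := by
  simp [adjWeight, parallelSubdivision]

@[simp]
theorem adjWeight_parallelSubdivision_inr_inr (p q : G.edgeSet × Fin k) :
    adjWeight (parallelSubdivision G k) (Sum.inr p) (Sum.inr q) = 0 := by
  simp [adjWeight, parallelSubdivision]

@[simp]
theorem adjWeight_parallelSubdivision_inl_inr (v : V) (p : G.edgeSet × Fin k) :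
    adjWeight (parallelSubdivision G k) (Sum.inl v) (Sum.inr p) = incWeight p.1 v := by
  by_cases h : v ∈ (p.1 : Sym2 V) <;> simp [adjWeight, parallelSubdivision, incWeight, h]

@[simp]
theorem adjWeight_parallelSubdivision_inr_inl (v : V) (p : G.edgeSet × Fin k) :
    adjWeight (parallelSubdivision G k) (Sum.inr p) (Sum.inl v) = incWeight p.1 v := by
  by_cases h : v ∈ (p.1 : Sym2 V) <;> simp [adjWeight, parallelSubdivision, incWeight, h]

theorem sum_edge_prod [Fintype G.edgeSet] (f : G.edgeSet → ℝ) :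
    ∑ p : G.edgeSet × Fin k, f p.1 = k * ∑ e, f e := by
  rw [Fintype.sum_prod_type, Finset.mul_sum]
  simp

theorem card_parallelSubdivision_vertex [Finite V] :
    (Nat.card (V ⊕ (G.edgeSet × Fin k)) : ℝ) = Nat.card V + k * G.edgeSet.ncard := by
  rw [Nat.card_sum, Nat.card_prod, Nat.card_coe_set_eq, Nat.card_fin]
  push_cast
  ring

variable [Fintype V] [Fintype G.edgeSet]

@[simp]
theorem realDegree_parallelSubdivision_inl (v : V) :
    realDegree (parallelSubdivision G k) (Sum.inl v) = k * realDegree G v := by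
  simp [realDegree.eq_def (parallelSubdivision G k), sum_edge_prod (fun e => incWeight e v),
    sum_incWeight_edge]

@[simp]
theorem realDegree_parallelSubdivision_inr (p : G.edgeSet × Fin k) :
    realDegree (parallelSubdivision G k) (Sum.inr p) = 2 := by
  simp [realDegree.eq_def (parallelSubdivision G k), sum_incWeight_vertex]

theorem sum_realDegree_parallelSubdivision :
    ∑ x, realDegree (parallelSubdivision G k) x = 2 * k * ∑ v, realDegree G v := by
  have h : (Fintype.card G.edgeSet : ℝ) = G.edgeSet.ncard := by
    rw [← Nat.card_coe_set_eq, Nat.card_eq_fintype_card]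
  simp only [Fintype.sum_sum_type, realDegree_parallelSubdivision_inl,
    realDegree_parallelSubdivision_inr, ← Finset.mul_sum, Finset.sum_const, Finset.card_univ,
    Fintype.card_prod, Fintype.card_fin, nsmul_eq_mul, Nat.cast_mul, h]
  rw [sum_realDegree]
  ring

open Classical in
/-- The Green kernel of `S_k(G)` built from one of `G` by harmonic extension. -/
noncomputable def subdivisionKernel (k : ℕ) (g : V → V → ℝ) :
    V ⊕ (G.edgeSet × Fin k) → V ⊕ (G.edgeSet × Fin k) → ℝ
  | Sum.inl v, Sum.inl w => 2 / k * g v w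
  | Sum.inl v, Sum.inr q => 1 / k * ∑ w, incWeight q.1 w * g v w
  | Sum.inr p, Sum.inl w => 1 / k * ∑ v, incWeight p.1 v * g v w
  | Sum.inr p, Sum.inr q =>
      1 / (2 * k) * ∑ v, incWeight p.1 v * ∑ w, incWeight q.1 w * g v w
        + if p = q then 1 / 2 else 0

theorem sum_incWeight_mul_sum (v : V) (f : V → ℝ) :
    ∑ p : G.edgeSet × Fin k, incWeight p.1 v * ∑ w, incWeight p.1 w * f w
      = k * (∑ w, adjWeight G v w * f w + realDegree G v * f v) := by
  classical
  rw [sum_edge_prod (fun e => incWeight e v * ∑ w, incWeight e w * f w)]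
  congr 1
  simp only [Finset.mul_sum, ← mul_assoc]
  rw [Finset.sum_comm]
  simp only [← Finset.sum_mul, sum_incWeight_mul_incWeight, add_mul, Finset.sum_add_distrib,
    ite_mul, zero_mul, Finset.sum_ite_eq, Finset.mem_univ, if_true]

theorem IsGreenKernel.subdivisionKernel {π : V → ℝ} {g : V → V → ℝ} (hg : IsGreenKernel G π g)
    (hk : k ≠ 0) :
    IsGreenKernel (parallelSubdivision G k) (Sum.elim π 0) (subdivisionKernel k g) := by
  classical
  have hk' : (k : ℝ) ≠ 0 := by exact_mod_cast hk
  rintro (j | q) (v | p)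
  · have h := hg j v
    have h2 := sum_incWeight_mul_sum (k := k) (G := G) v (fun w => g w j)
    simp only [Fintype.sum_sum_type, realDegree_parallelSubdivision_inl,
      adjWeight_parallelSubdivision_inl_inl, adjWeight_parallelSubdivision_inl_inr,
      _root_.subdivisionKernel, zero_mul, Finset.sum_const_zero, zero_add, Sum.elim_inl,
      Sum.inl.injEq, mul_left_comm (incWeight _ _) (1 / (k : ℝ)), ← Finset.mul_sum]
    rw [h2, ← h]
    field_simp
    ring
  · simp only [Fintype.sum_sum_type, realDegree_parallelSubdivision_inr,
      adjWeight_parallelSubdivision_inr_inl, adjWeight_parallelSubdivision_inr_inr,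
      _root_.subdivisionKernel, zero_mul, Finset.sum_const_zero, add_zero, Sum.elim_inr,
      reduceCtorEq, if_false, mul_left_comm (incWeight _ _) (2 / (k : ℝ)), ← Finset.mul_sum,
      Pi.zero_apply]
    ring
  -- Source at a middle vertex, tested at an old one: add the Green equations of `G` over both ends
  -- of `q`, which doubles the sink.
  · have h : realDegree G v * ∑ j, incWeight q.1 j * g v j
        - ∑ w, adjWeight G v w * ∑ j, incWeight q.1 j * g w j = incWeight q.1 v - 2 * π v := by
      have h1 := Finset.sum_congr (rfl : (Finset.univ : Finset V) = _)
        fun j _ => congrArg (incWeight q.1 j * ·) (hg j v)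
      simp only [mul_sub, Finset.sum_sub_distrib, mul_ite, mul_one, mul_zero,
        Finset.sum_ite_eq, Finset.mem_univ, if_true, ← Finset.sum_mul,
        sum_incWeight_vertex] at h1
      rw [← h1, Finset.mul_sum]
      simp only [Finset.mul_sum]
      rw [Finset.sum_comm]
      simp only [mul_left_comm]
    have h2 := sum_incWeight_mul_sum (k := k) (G := G) v
      (fun w => ∑ j, incWeight q.1 j * g w j)
    simp only [Fintype.sum_sum_type, realDegree_parallelSubdivision_inl,
      adjWeight_parallelSubdivision_inl_inl, adjWeight_parallelSubdivision_inl_inr,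
      _root_.subdivisionKernel, zero_mul, Finset.sum_const_zero, zero_add, Sum.elim_inl,
      reduceCtorEq, if_false, mul_add, Finset.sum_add_distrib,
      mul_left_comm (incWeight _ _) (1 / (2 * (k : ℝ))), ← Finset.mul_sum, mul_ite, mul_zero,
      Finset.sum_ite_eq', Finset.mem_univ, if_true]
    rw [h2]
    have h3 : π v = (incWeight q.1 v - (realDegree G v * ∑ j, incWeight q.1 j * g v j
        - ∑ w, adjWeight G v w * ∑ j, incWeight q.1 j * g w j)) / 2 := by
      rw [h]; ring
    rw [h3]
    field_simp
    ring
  · simp only [Fintype.sum_sum_type, realDegree_parallelSubdivision_inr,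
      adjWeight_parallelSubdivision_inr_inl, adjWeight_parallelSubdivision_inr_inr,
      _root_.subdivisionKernel, zero_mul, Finset.sum_const_zero, add_zero, Sum.elim_inr,
      mul_left_comm (incWeight _ _) (1 / (k : ℝ)), ← Finset.mul_sum,
      Pi.zero_apply, Sum.inr.injEq]
    split_ifs <;> · field_simp; ring

/-- Over the middle vertices, the incidence products give `k` times the degree and adjacency sums of
`g`; Foster's theorem evaluates the latter. -/
theorem IsGreenKernel.sum_subdivisionKernel_diag [Nonempty V] {π : V → ℝ} {g : V → V → ℝ}
    (hg : IsGreenKernel G π g) (hk : k ≠ 0) :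
    ∑ x, realDegree (parallelSubdivision G k) x * _root_.subdivisionKernel k g x x
      = 4 * ∑ v, realDegree G v * g v v - Fintype.card V + 1 + k * G.edgeSet.ncard := by
  have hk' : (k : ℝ) ≠ 0 := by exact_mod_cast hk
  have hc : (Fintype.card G.edgeSet : ℝ) = G.edgeSet.ncard := by
    rw [← Nat.card_coe_set_eq, Nat.card_eq_fintype_card]
  have h : ∑ p : G.edgeSet × Fin k,
      ∑ v, incWeight p.1 v * ∑ w, incWeight p.1 w * g v w
      = k * (2 * ∑ v, realDegree G v * g v v - Fintype.card V + 1) := by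
    rw [Finset.sum_comm]
    simp only [sum_incWeight_mul_sum]
    rw [← Finset.mul_sum, Finset.sum_add_distrib, hg.sum_adjWeight_mul]
    ring
  simp only [Fintype.sum_sum_type, realDegree_parallelSubdivision_inl,
    realDegree_parallelSubdivision_inr, _root_.subdivisionKernel, if_true,
    mul_add, Finset.sum_add_distrib, ← Finset.mul_sum, h, Finset.sum_const, Finset.card_univ,
    Fintype.card_prod, Fintype.card_fin, nsmul_eq_mul, Nat.cast_mul, hc]
  have h1 : ∑ v, k * realDegree G v * (2 / k * g v v) = 2 * ∑ v, realDegree G v * g v v := by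
    rw [Finset.mul_sum]
    refine Finset.sum_congr rfl fun v _ => ?_
    field_simp
  rw [h1]
  field_simp
  ring

theorem sum_incWeight_mul_eq (f : V → ℝ) :
    ∑ p : G.edgeSet × Fin k, ∑ v, incWeight p.1 v * f v = k * ∑ v, realDegree G v * f v := by
  rw [Finset.sum_comm, Finset.mul_sum]
  refine Finset.sum_congr rfl fun v _ => ?_
  rw [← Finset.sum_mul, sum_edge_prod (fun e => incWeight e v), sum_incWeight_edge, mul_assoc]

/-- Degree-weighted sums over middle vertices reduce to those over `V`. The last term collects `2 *
2 * (1/2)` from each of the `k * m` middle vertices. -/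
theorem sum_subdivisionKernel (g : V → V → ℝ) (hk : k ≠ 0) :
    ∑ x, ∑ y, realDegree (parallelSubdivision G k) x * realDegree (parallelSubdivision G k) y
        * subdivisionKernel k g x y
      = 8 * k * ∑ v, ∑ w, realDegree G v * realDegree G w * g v w
        + 2 * k * G.edgeSet.ncard := by
  classical
  have hk' : (k : ℝ) ≠ 0 := by exact_mod_cast hk
  have hc : (Fintype.card G.edgeSet : ℝ) = G.edgeSet.ncard := by
    rw [← Nat.card_coe_set_eq, Nat.card_eq_fintype_card]
  have hrow : ∀ v, ∑ y, realDegree (parallelSubdivision G k) y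
      * subdivisionKernel (G := G) k g (Sum.inl v) y = 4 * ∑ w, realDegree G w * g v w := by
    intro v
    simp only [Fintype.sum_sum_type, realDegree_parallelSubdivision_inl,
      realDegree_parallelSubdivision_inr, subdivisionKernel, ← Finset.mul_sum,
      sum_incWeight_mul_eq]
    have h1 : ∑ w, k * realDegree G w * (2 / k * g v w) = 2 * ∑ w, realDegree G w * g v w := by
      rw [Finset.mul_sum]
      refine Finset.sum_congr rfl fun w _ => ?_
      field_simp
    rw [h1]
    field_simp
    ring
  have hrow' : ∀ p, ∑ y, realDegree (parallelSubdivision G k) y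
      * subdivisionKernel (G := G) k g (Sum.inr p) y
      = 2 * ∑ v, incWeight p.1 v * ∑ w, realDegree G w * g v w + 1 := by
    intro p
    have h2 : ∑ q : G.edgeSet × Fin k, ∑ v, incWeight p.1 v * ∑ w, incWeight q.1 w * g v w
        = k * ∑ v, incWeight p.1 v * ∑ w, realDegree G w * g v w := by
      rw [Finset.sum_comm, Finset.mul_sum]
      refine Finset.sum_congr rfl fun v _ => ?_
      rw [← Finset.mul_sum, sum_incWeight_mul_eq]
      ring
    have h1 : ∑ w, k * realDegree G w * (1 / k * ∑ v, incWeight p.1 v * g v w)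
        = ∑ v, incWeight p.1 v * ∑ w, realDegree G w * g v w := by
      simp only [Finset.mul_sum]
      rw [Finset.sum_comm]
      refine Finset.sum_congr rfl fun v _ => Finset.sum_congr rfl fun w _ => ?_
      field_simp
    simp only [Fintype.sum_sum_type, realDegree_parallelSubdivision_inl,
      realDegree_parallelSubdivision_inr, subdivisionKernel, mul_add, Finset.sum_add_distrib,
      ← Finset.mul_sum, h1, h2, Finset.sum_ite_eq, Finset.mem_univ, if_true]
    field_simp
    ring
  simp only [mul_assoc, ← Finset.mul_sum]
  rw [Fintype.sum_sum_type]
  simp only [hrow, hrow', realDegree_parallelSubdivision_inl, realDegree_parallelSubdivision_inr,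
    mul_add, Finset.sum_add_distrib, ← Finset.mul_sum, sum_incWeight_mul_eq, Finset.sum_const,
    Finset.card_univ, Fintype.card_prod, Fintype.card_fin, nsmul_eq_mul, Nat.cast_mul, hc]
  simp only [mul_assoc, mul_left_comm _ (4 : ℝ), ← Finset.mul_sum]
  ring

theorem IsGreenKernel.multDegreeKirchhoff_parallelSubdivision [Nonempty V] {π : V → ℝ}
    {g : V → V → ℝ} (hg : IsGreenKernel G π g) (hk : k ≠ 0) :
    multDegreeKirchhoff (parallelSubdivision G k) =
      8 * k * multDegreeKirchhoff G + 2 * k * G.edgeSet.ncard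
        * (1 + 2 * k * G.edgeSet.ncard - 2 * Fintype.card V) := by
  rw [(hg.subdivisionKernel hk).multDegreeKirchhoff_eq, hg.multDegreeKirchhoff_eq,
    sum_realDegree_parallelSubdivision, hg.sum_subdivisionKernel_diag hk,
    sum_subdivisionKernel g hk, sum_realDegree]
  ring

theorem ncard_edgeSet_parallelSubdivision :
    ((parallelSubdivision G k).edgeSet.ncard : ℝ) = 2 * k * G.edgeSet.ncard := by
  have h := sum_realDegree_parallelSubdivision (G := G) (k := k)
  rw [sum_realDegree, sum_realDegree] at h
  linarith

end Subdivision

/-! ### Iteration and the closed form -/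

/-- `S_k` acts on the Kirchhoff index of graphs with a Green kernel, and preserves such graphs. -/
theorem multDegreeKirchhoff_parallelSubdivision {V : Type u} [Finite V] [Nonempty V]
    {G : SimpleGraph V} {k : ℕ} (hk : k ≠ 0)
    (hG : ∀ [Fintype V], ∃ π g, IsGreenKernel G π g) :
    multDegreeKirchhoff (parallelSubdivision G k) =
      8 * k * multDegreeKirchhoff G + 2 * k * G.edgeSet.ncard
        * (1 + 2 * k * G.edgeSet.ncard - 2 * Nat.card V) := by
  have := Fintype.ofFinite V
  have := Fintype.ofFinite G.edgeSet
  obtain ⟨π, g, hg⟩ := hG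
  rw [hg.multDegreeKirchhoff_parallelSubdivision hk, Nat.card_eq_fintype_card]

/-- Carrying a Green kernel along makes connectedness of the iterates unnecessary. The vertex count
is a geometric sum, cleared of its denominator `2 * k - 1`. -/
theorem FiniteGraph.iterSubdivision_invariants {V : Type u} [Finite V] {G : SimpleGraph V}
    (hG : G.Connected) {k : ℕ} (hk : k ≠ 0) (r : ℕ) :
    Nonempty ((FiniteGraph.mk V inferInstance G).iterSubdivision k r).vertex ∧
    (∀ [Fintype ((FiniteGraph.mk V inferInstance G).iterSubdivision k r).vertex],
      ∃ π g, IsGreenKernel ((FiniteGraph.mk V inferInstance G).iterSubdivision k r).graph π g) ∧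
    (((FiniteGraph.mk V inferInstance G).iterSubdivision k r).graph.edgeSet.ncard : ℝ)
      = (2 * k) ^ r * G.edgeSet.ncard ∧
    (2 * k - 1 : ℝ) * Nat.card ((FiniteGraph.mk V inferInstance G).iterSubdivision k r).vertex
      = (2 * k - 1) * Nat.card V + k * G.edgeSet.ncard * ((2 * k) ^ r - 1) := by
  induction r with
  | zero =>
    refine ⟨hG.nonempty, fun {inst} => ?_, ?_, ?_⟩
    · exact @SimpleGraph.Connected.exists_isGreenKernel _ inst _ hG
    · simp [FiniteGraph.iterSubdivision]
    · simp [FiniteGraph.iterSubdivision]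
  | succ r ih =>
    obtain ⟨h1, h2, h3, h4⟩ := ih
    have f1 := Fintype.ofFinite ((FiniteGraph.mk V inferInstance G).iterSubdivision k r).vertex
    have f2 := Fintype.ofFinite
      ((FiniteGraph.mk V inferInstance G).iterSubdivision k r).graph.edgeSet
    refine ⟨⟨Sum.inl h1.some⟩, fun {inst} => ?_, ?_, ?_⟩
    · obtain ⟨π, g, hg⟩ := h2
      have h := hg.subdivisionKernel hk
      rw [Subsingleton.elim (instFintypeSum _ _) inst] at h
      exact ⟨_, _, h⟩
    · change ((parallelSubdivision
        ((FiniteGraph.mk V inferInstance G).iterSubdivision k r).graph k).edgeSet.ncard : ℝ) = _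
      rw [ncard_edgeSet_parallelSubdivision, h3]
      ring
    · change (2 * k - 1 : ℝ) * (Nat.card
        (((FiniteGraph.mk V inferInstance G).iterSubdivision k r).vertex ⊕
          (((FiniteGraph.mk V inferInstance G).iterSubdivision k r).graph.edgeSet × Fin k)) : ℝ)
        = _
      rw [card_parallelSubdivision_vertex, mul_add, h4, h3]
      ring

theorem mainTheorem6 {V : Type u} [Finite V] (G : SimpleGraph V) (hG : G.Connected)
    (n m : ℕ) (hn : Nat.card V = n) (hm : G.edgeSet.ncard = m) :
    (∀ k : ℕ, 1 ≤ k →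
      multDegreeKirchhoff (parallelSubdivision G k) =
        8 * (k : ℝ) * multDegreeKirchhoff G +
          2 * (k : ℝ) * (m : ℝ) * (1 + 2 * (k : ℝ) * (m : ℝ) - 2 * (n : ℝ))) ∧
    (∀ k r : ℕ, 2 < k → 1 ≤ r →
      multDegreeKirchhoff ((FiniteGraph.mk V inferInstance G).iterSubdivision k r).graph =
        (8 * (k : ℝ)) ^ r * multDegreeKirchhoff G
        + (2 * (k : ℝ)) ^ r * ((4 : ℝ) ^ r - 1) / 3 * ((m : ℝ) - 2 * (m : ℝ) * (n : ℝ))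
        + (k : ℝ) * (4 * (k : ℝ)) ^ r * ((k : ℝ) ^ r - (2 : ℝ) ^ r) / ((k : ℝ) - 2) * (m : ℝ) ^ 2
        - (k : ℝ) * (2 * (k : ℝ)) ^ r *
            ((4 : ℝ) ^ r - 2 * (k : ℝ) * ((4 : ℝ) ^ r - 1) + 3 * (2 * (k : ℝ)) ^ r - 4) /
            (3 * ((k : ℝ) - 2) * (2 * (k : ℝ) - 1)) * (m : ℝ) ^ 2) := by
  have := hG.nonempty
  subst hn hm
  refine ⟨fun k hk => multDegreeKirchhoff_parallelSubdivision (by omega)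
    hG.exists_isGreenKernel, fun k r hk hr => ?_⟩
  -- The formula also holds at `r = 0`, where the bracket is `1 + 3 - 4 = 0`, so induction starts
  -- there.
  clear hr
  have hk2 : (2 : ℝ) < k := by exact_mod_cast hk
  have hA : (k : ℝ) - 2 ≠ 0 := by linarith
  have hB : 2 * (k : ℝ) - 1 ≠ 0 := by linarith
  induction r with
  | zero =>
    simp only [FiniteGraph.iterSubdivision]
    ring
  | succ r ih =>
    obtain ⟨h1, h2, h3, h4⟩ := FiniteGraph.iterSubdivision_invariants hG (k := k) (by omega) r
    have h5 := multDegreeKirchhoff_parallelSubdivision (k := k) (by omega) h2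
    have h6 : (Nat.card ((FiniteGraph.mk V inferInstance G).iterSubdivision k r).vertex : ℝ)
        = Nat.card V + k * G.edgeSet.ncard * ((2 * k) ^ r - 1) / (2 * k - 1) := by
      apply mul_left_cancel₀ hB
      rw [h4, mul_add, mul_div_cancel₀ _ hB]
    rw [h3, h6] at h5
    refine h5.trans ?_
    -- Every power becomes a monomial in `2 ^ r` and `k ^ r`, leaving a rational identity in `x`,
    -- `y`, `k`.
    have e8 : (8 * k : ℝ) ^ r = (2 ^ r) ^ 3 * k ^ r := by
      rw [mul_pow, ← pow_mul, mul_comm r, pow_mul]; norm_num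
    have e4 : (4 : ℝ) ^ r = (2 ^ r) ^ 2 := by
      rw [← pow_mul, mul_comm r, pow_mul]; norm_num
    rw [ih]
    simp only [pow_succ _ r, e8, mul_pow, e4]
    generalize (2 : ℝ) ^ r = x
    generalize (k : ℝ) ^ r = y
    field_simp
    ring
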